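/- **Model.** Each of $n$ users is placed independently and uniformly at random in the unit square and never moves. Time is slotted. In every slot each node is, independently, a sender with probability $\theta\in(0,\tfrac12)$ and a potential receiver otherwise; every sender $i$ attempts to transmit one packet to its nearest potential receiver $j(i)$. The transmission succeeds if and only if $$\mathrm{SINR}_{i,j(i)}=\frac{P\,r_{i,j(i)}^{-\alpha}}{\eta+\sum_{l\ne i,\ l\text{ a sender}}P\,r_{l,j(i)}^{-\alpha}}\ \ge\ \beta ,$$ where $r_{ij}$ is the Euclidean distance between nodes $i$ and $j$, and $P>0$, $\alpha>2$, $\eta>0$, $\beta>0$, $\theta$ are constants independent of $n$. If several packets addressed to the same node succeed in the same slot (which is impossible if $\beta\ge 1$), the node stores a subset of them (for instance all, or just one of them), determined by an arbitrary fixed rule. Under RANDOM PUSH, a sender transmits a message chosen uniformly at random among the messages it possesses at that moment. The designations of the nodes and the messages chosen are, given the past, independent over the nodes. **Theorem.** Let $w=w(n)$ be integers with $w=\omega(\mathrm{polylog}\,n)$, that is, $(\log n)^c/w(n)\to0$ for every $c\ge 0$. Suppose that there are $k\le n$ distinct messages, and that a new message $M^*$, arriving later than the other $k-1$ messages, is injected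 at a single node at a moment when every node already possesses at least $w$ of the other $k-1$ messages (the set of messages held by each node at this moment may be random and may depend on the locations of the nodes). Let $T^*$ be the number of slots after the injection until every node possesses $M^*$ (with $T^*=\infty$ if this never happens) under RANDOM PUSH. Then for every constant $\epsilon>0$ and all sufficiently large $n$, $$\mathbb P\left(T^*>w^{1-\epsilon}\sqrt{\frac{n}{128\log n}}\right)>1-n^{-2},$$ where how large $n$ must be depends only on $\epsilon$, the function $w$ and the constants $P,\alpha,\eta,\beta,\theta$. -/

import Mathlib

open MeasureTheory ProbabilityTheory Filter Topology
open scoped ENNReal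

noncomputable section

namespace Gossip

/-- The Euclidean plane, in which the users live. -/
abbrev Plane : Type := EuclideanSpace ℝ (Fin 2)

/-- The square of unit area. -/
def unitSquare : Set Plane := {x | ∀ c, x c ∈ Set.Icc (0 : ℝ) 1}

/-- The constants of the wireless network, none of which depends on the number of users. -/
structure Radio where
  /-- common transmission power -/
  power : ℝ
  /-- path loss exponent -/
  pathLoss : ℝ
  /-- noise power -/
  noise : ℝ
  /-- SINR threshold required for a successful reception -/
  threshold : ℝ
  /-- probability with which a node is designated as a sender in a slot -/
  sendProb : ℝ
  power_pos : 0 < power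
  two_lt_pathLoss : 2 < pathLoss
  noise_pos : 0 < noise
  threshold_pos : 0 < threshold
  sendProb_pos : 0 < sendProb
  sendProb_lt : sendProb < 1 / 2

variable {n k : ℕ}

/-- What the nodes do in one time slot: `none` means that the node is a potential receiver,
`some c` means that it is a sender and transmits the message `c`. -/
abbrev Action (n k : ℕ) : Type := Fin n → Option (Fin k)

/-- Which messages each node possesses. -/
abbrev Holdings (n k : ℕ) : Type := Fin n → Finset (Fin k)

/-- The set of transmitters of a slot. -/
def senders (a : Action n k) : Finset (Fin n) := Finset.univ.filter fun i => a i ≠ none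

/-- The power with which `j` receives the signal of transmitter `i`. -/
def Radio.signal (R : Radio) (x : Fin n → Plane) (i j : Fin n) : ℝ :=
  R.power * dist (x i) (x j) ^ (-R.pathLoss)

/-- The signal-to-interference-plus-noise ratio at `j` of the signal of transmitter `i`. -/
def Radio.sinr (R : Radio) (x : Fin n → Plane) (a : Action n k) (i j : Fin n) : ℝ :=
  R.signal x i j / (R.noise + ∑ l ∈ (senders a).erase i, R.signal x l j)

/-- `i` is a sender and `j` is its nearest potential receiver. -/
def IsLink (x : Fin n → Plane) (a : Action n k) (i j : Fin n) : Prop :=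
  a i ≠ none ∧ a j = none ∧ ∀ l, a l = none → dist (x i) (x j) ≤ dist (x i) (x l)

open Classical in
/-- The senders that attempt to transmit to `j` in this slot and whose SINR at `j` reaches the
threshold. -/
def Radio.decodable (R : Radio) (x : Fin n → Plane) (a : Action n k) (j : Fin n) :
    Finset (Fin n) :=
  Finset.univ.filter fun i => IsLink x a i j ∧ R.threshold ≤ R.sinr x a i j

/-- A reception rule: it says which of the decodable packets addressed to node `j` are stored by
`j`. With `keep j s = s` all of them are stored; the rules with `(keep j s).card ≤ 1` express that
a node can receive at most one message per slot. For a threshold of at least `1` no two packets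
are decodable at the same node in the same slot. -/
abbrev ReceptionRule (n : ℕ) : Type := Fin n → Finset (Fin n) → Finset (Fin n)

/-- The evolution of the holdings in one time slot. -/
def Radio.step (R : Radio) (keep : ReceptionRule n) (x : Fin n → Plane) (a : Action n k)
    (h : Holdings n k) : Holdings n k :=
  fun j => h j ∪ (keep j (R.decodable x a j)).biUnion fun i => (a i).toFinset

/-- The holdings after `t` slots, in a static network with locations `x` and initial holdings
`h₀`, when the nodes do `a s` in slot `s`. -/
def Radio.holdings (R : Radio) (keep : ReceptionRule n) (x : Fin n → Plane) (h₀ : Holdings n k)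
    (a : ℕ → Action n k) : ℕ → Holdings n k
  | 0 => h₀
  | t + 1 => R.step keep x (a t) (R.holdings keep x h₀ a t)

/-- The first time at which every node possesses the message `c` (`⊤` if there is none). -/
def Radio.spreadTime (R : Radio) (keep : ReceptionRule n) (x : Fin n → Plane)
    (h₀ : Holdings n k) (a : ℕ → Action n k) (c : Fin k) : ℕ∞ :=
  ⨅ (t : ℕ) (_ : ∀ i, c ∈ R.holdings keep x h₀ a t i), (t : ℕ∞)

/-- The probability, under UNICAST and RANDOM PUSH, that a node possessing the set `s` of messages
does `b`: it is a sender with probability `θ`, and a sender selects uniformly at random one of the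
messages that it possesses. -/
def pushProb (θ : ℝ) (s : Finset (Fin k)) (b : Option (Fin k)) : ℝ :=
  b.elim (1 - θ) fun c => if c ∈ s then θ / s.card else 0

/-- `X` (locations), `H₀` (initial holdings) and `act` (actions in the slots `0, 1, …`) form a
RANDOM PUSH process over a static random network. The σ-algebra `ℱ t` describes the past of
slot `t`. The initial holdings may depend on the locations in an arbitrary way. -/
structure IsRandomPush {Ω : Type*} [mΩ : MeasurableSpace Ω] (μ : Measure Ω) (R : Radio)
    (keep : ReceptionRule n) (ℱ : Filtration ℕ mΩ) (X : Fin n → Ω → Plane)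
    (H₀ : Ω → Holdings n k) (act : ℕ → Ω → Action n k) : Prop where
  measurable_loc : ∀ i, Measurable[ℱ 0] (X i)
  measurable_init : ∀ h, MeasurableSet[ℱ 0] {ω | H₀ ω = h}
  measurable_act : ∀ t a, MeasurableSet[ℱ (t + 1)] {ω | act t ω = a}
  /-- the users are placed independently … -/
  indep_loc : iIndepFun X μ
  /-- … and uniformly over the unit square -/
  uniform_loc : ∀ i, μ.map (X i) = volume.restrict unitSquare
  /-- given the past, the nodes act independently of each other -/
  cond_act : ∀ t a, μ⟦{ω | act t ω = a}|ℱ t⟧ =ᵐ[μ] fun ω =>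
    ∏ i, pushProb R.sendProb
      (R.holdings keep (fun l => X l ω) (H₀ ω) (fun s => act s ω) t i) (a i)

/-- `w(n) = ω(polylog n)`: `w` grows faster than every power of `log n`. -/
def SuperPolylog (w : ℕ → ℕ) : Prop :=
  ∀ c : ℕ, (fun n : ℕ => Real.log n ^ c) =o[atTop] fun n : ℕ => (w n : ℝ)

end Gossip

end

/-!
Almost surely all distances between nodes differ, so a sender has exactly one nearest receiver, and
in a given slot a given node sends the new message with conditional probability at most `1 / w`.
Cut the square into cells of side of order `√(log n / n)`. It is unlikely that a node sends the new
message while its cell contains no receiver, so the message uses only links of length `r` of the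
order of the side of a cell.

Consider the nodes reached from a source `s` over such short links and the sum of `exp (l * d)` over
them, where `d` is the distance to `s` and `l = 1 / r`. A transmission over a short link adds at
most `exp 1` times the weight of its sender, so the expectation of the sum grows at most by the
factor `1 + exp 1 / w` per slot and stays below `exp (c / r)`, with a small constant `c`, for a time
of order `w / r`. By Markov's inequality no node at distance `1 / 4` from `s` is reached by then.
But two opposite corner cells are occupied with high probability, and one of their nodes is at
distance at least `1 / 4` from the source.
-/

namespace Gossip

section ConditionalProbability

variable {Ω : Type*} {m m₀ : MeasurableSpace Ω} {μ : Measure Ω} [IsFiniteMeasure μ]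
  {A B : Set Ω} {q : ℝ}

theorem measureReal_inter_le_of_condExp_le (hm : m ≤ m₀) (hA : MeasurableSet[m] A)
    (hB : MeasurableSet B) (h : ∀ᵐ ω ∂μ, ω ∈ A → (μ⟦B | m⟧) ω ≤ q) :
    μ.real (A ∩ B) ≤ q * μ.real A := by
  have hint : Integrable (B.indicator fun _ => (1 : ℝ)) μ := (integrable_const 1).indicator hB
  calc μ.real (A ∩ B)
      = ∫ ω in A, (μ⟦B | m⟧) ω ∂μ := by
        rw [setIntegral_condExp hm hint hA, integral_indicator_const _ hB, smul_eq_mul, mul_one,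
          measureReal_restrict_apply hB, Set.inter_comm]
    _ ≤ ∫ _ in A, q ∂μ :=
        setIntegral_mono_on_ae integrable_condExp.integrableOn (integrable_const q) (hm _ hA) h
    _ = q * μ.real A := by rw [setIntegral_const, smul_eq_mul, mul_comm]

theorem ae_condExp_indicator_ne_zero (hm : m ≤ m₀) (hB : MeasurableSet B) :
    ∀ᵐ ω ∂μ, ω ∈ B → (μ⟦B | m⟧) ω ≠ 0 := by
  have hA : MeasurableSet[m] {ω | (μ⟦B | m⟧) ω = 0} :=
    stronglyMeasurable_condExp.measurable (measurableSet_singleton 0)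
  have hnull := measureReal_inter_le_of_condExp_le hm hA hB (ae_of_all μ fun _ hω => le_of_eq hω)
  rw [zero_mul] at hnull
  have := (measureReal_eq_zero_iff).1 (hnull.antisymm measureReal_nonneg)
  filter_upwards [measure_eq_zero_iff_ae_notMem.1 this] with ω hω hB h0
  exact hω ⟨h0, hB⟩

theorem setLIntegral_le_of_condExp_le (hm : m ≤ m₀) (hB : MeasurableSet B)
    (h : ∀ᵐ ω ∂μ, (μ⟦B | m⟧) ω ≤ q) {f : Ω → ℝ≥0∞} (hf : Measurable[m] f) :
    ∫⁻ ω in B, f ω ∂μ ≤ ENNReal.ofReal q * ∫⁻ ω, f ω ∂μ := by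
  rw [← lintegral_trim hm hf, ← lintegral_trim hm hf, ← smul_eq_mul, ← lintegral_smul_measure]
  refine lintegral_mono' (Measure.le_intro fun A hA _ => ?_) le_rfl
  rw [trim_measurableSet_eq hm hA, Measure.restrict_apply (hm _ hA), Measure.smul_apply,
    trim_measurableSet_eq hm hA, smul_eq_mul, ← ofReal_measureReal, ← ofReal_measureReal (s := A),
    ← ENNReal.ofReal_mul' measureReal_nonneg]
  exact ENNReal.ofReal_le_ofReal
    (measureReal_inter_le_of_condExp_le hm hA hB (h.mono fun _ hω _ => hω))

end ConditionalProbability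

section RandomPoints

theorem measurableSet_forall_mem_iff {Ω ι β : Type*} {_ : MeasurableSpace Ω} [Countable ι]
    [MeasurableSpace β] {X : ι → Ω → β} (hX : ∀ i, Measurable (X i)) {Q : Set β}
    (hQ : MeasurableSet Q) (S : Set ι) : MeasurableSet {ω | ∀ i, X i ω ∈ Q ↔ i ∈ S} :=
  measurableSet_setOfPred.2 <| .forall fun i =>
    (measurableSet_setOfPred.1 (hX i hQ)).iff measurable_const

variable {Ω : Type*} [MeasurableSpace Ω] {μ : Measure Ω} [IsProbabilityMeasure μ]

theorem measureReal_forall_mem_iff {ι β : Type*} [Fintype ι] [MeasurableSpace β]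
    {X : ι → Ω → β} (hind : iIndepFun X μ) (hX : ∀ i, Measurable (X i)) {Q : Set β}
    (hQ : MeasurableSet Q) {p : ℝ} (hp : ∀ i, μ.real (X i ⁻¹' Q) = p) (S : Finset ι) :
    μ.real {ω | ∀ i, X i ω ∈ Q ↔ i ∈ S} = p ^ S.card * (1 - p) ^ (Fintype.card ι - S.card) := by
  classical
  let U : ι → Set β := fun i => if i ∈ S then Q else Qᶜ
  have hU : ∀ i, MeasurableSet (U i) := fun i => by
    dsimp only [U]
    split_ifs
    exacts [hQ, hQ.compl]
  have hpU : ∀ i, μ.real (X i ⁻¹' U i) = if i ∈ S then p else 1 - p := fun i => by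
    by_cases hi : i ∈ S
    · simp only [U, if_pos hi, hp]
    · simp only [U, if_neg hi, Set.preimage_compl, probReal_compl_eq_one_sub (hX i hQ), hp]
  have hset : {ω | ∀ i, X i ω ∈ Q ↔ i ∈ S} = ⋂ i ∈ Finset.univ, X i ⁻¹' U i := by
    ext ω
    simp only [Set.mem_iInter, Finset.mem_univ, forall_const]
    refine forall_congr' fun i => ?_
    by_cases hi : i ∈ S <;> simp [U, hi]
  rw [hset, measureReal_def, hind.measure_inter_preimage_eq_mul _ fun i _ => hU i,
    ENNReal.toReal_prod]
  simp_rw [← measureReal_def, hpU]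
  rw [Finset.prod_ite, Finset.prod_const, Finset.prod_const, Finset.filter_univ_mem,
    Finset.filter_not, Finset.filter_univ_mem, Finset.card_univ_sdiff]

theorem ae_dist_ne_of_indepFun {μ : Measure Ω} [IsFiniteMeasure μ] {E : Type*}
    [NormedAddCommGroup E] [NormedSpace ℝ E] [FiniteDimensional ℝ E] [Nontrivial E]
    [MeasurableSpace E] [BorelSpace E] {ν : Measure E} [ν.IsAddHaarMeasure] {U Z : Ω → E}
    {ρ : Ω → ℝ} (hU : Measurable U) (hρ : Measurable ρ) (hZ : Measurable Z)
    (hind : IndepFun (fun ω => (U ω, ρ ω)) Z μ) (hac : μ.map Z ≪ ν) :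
    ∀ᵐ ω ∂μ, dist (U ω) (Z ω) ≠ ρ ω := by
  have hUρ : Measurable fun ω => (U ω, ρ ω) := hU.prodMk hρ
  let T : Set ((E × ℝ) × E) := {z | dist z.1.1 z.2 = z.1.2}
  have hT : MeasurableSet T := measurableSet_eq_fun (by fun_prop) (by fun_prop)
  have hnull : (μ.map fun ω => ((U ω, ρ ω), Z ω)) T = 0 := by
    rw [(indepFun_iff_map_prod_eq_prod_map_map hUρ.aemeasurable hZ.aemeasurable).1 hind,
      Measure.measure_prod_null hT]
    refine ae_of_all _ fun z => hac ?_
    have hslice : Prod.mk z ⁻¹' T = Metric.sphere z.1 z.2 := by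
      ext y
      rw [Metric.mem_sphere, dist_comm]
      rfl
    rw [hslice, Measure.addHaar_sphere]
  rw [Measure.map_apply (hUρ.prodMk hZ) hT] at hnull
  exact measure_eq_zero_iff_ae_notMem.1 hnull

end RandomPoints

section Grid

/-- The cell with index `p` of the grid that divides the unit square into `m ^ 2` closed squares of
side `1 / m`. -/
def cell (m : ℕ) (p : Fin 2 → Fin m) : Set Plane :=
  {x | ∀ c, x c ∈ Set.Icc ((p c : ℝ) / m) (((p c : ℝ) + 1) / m)}

variable {m : ℕ} {p q : Fin 2 → Fin m} {x y : Plane}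

theorem measurableSet_unitSquare : MeasurableSet unitSquare :=
  measurableSet_setOfPred.2 <| .forall fun c => measurableSet_setOfPred.1 <|
    (by fun_prop : Measurable fun x : Plane => x c) measurableSet_Icc

theorem cell_subset_unitSquare (m : ℕ) (p : Fin 2 → Fin m) : cell m p ⊆ unitSquare := by
  intro x hx c
  have hm : (0 : ℝ) < m := by exact_mod_cast (p c).pos
  refine ⟨le_trans (by positivity) (hx c).1, (hx c).2.trans ?_⟩
  rw [div_le_one hm]
  exact_mod_cast (p c).isLt

theorem cell_eq_preimage (m : ℕ) (p : Fin 2 → Fin m) :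
    cell m p = (MeasurableEquiv.toLp 2 (Fin 2 → ℝ)).symm ⁻¹'
      Set.Icc (fun c => (p c : ℝ) / m) (fun c => ((p c : ℝ) + 1) / m) := by
  ext x
  exact forall_and

theorem measurableSet_cell (m : ℕ) (p : Fin 2 → Fin m) : MeasurableSet (cell m p) := by
  rw [cell_eq_preimage]
  exact MeasurableEquiv.measurable _ measurableSet_Icc

theorem measureReal_restrict_unitSquare_cell (m : ℕ) (p : Fin 2 → Fin m) :
    (volume.restrict unitSquare).real (cell m p) = 1 / (m : ℝ) ^ 2 := by
  rw [measureReal_def, Measure.restrict_eq_self _ (cell_subset_unitSquare m p), cell_eq_preimage,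
    (EuclideanSpace.volume_preserving_symm_measurableEquiv_toLp (Fin 2)).measure_preimage
      measurableSet_Icc.nullMeasurableSet, Real.volume_Icc_pi_toReal fun c => by gcongr; simp,
    Fin.prod_univ_two]
  ring

theorem exists_mem_cell (hm : 0 < m) (hx : x ∈ unitSquare) : ∃ p, x ∈ cell m p := by
  have hm' : (0 : ℝ) < m := by exact_mod_cast hm
  -- The minimum with `m - 1` puts the points with a coordinate equal to `1` into a last cell.
  refine ⟨fun c => ⟨min ⌊x c * m⌋₊ (m - 1), by omega⟩, fun c => ?_⟩
  have h0 : 0 ≤ x c * m := mul_nonneg (hx c).1 hm'.le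
  rw [Set.mem_Icc, div_le_iff₀ hm', le_div_iff₀ hm']
  refine ⟨le_trans (by exact_mod_cast min_le_left _ _) (Nat.floor_le h0), ?_⟩
  rcases le_total ⌊x c * m⌋₊ (m - 1) with h | h
  · simpa only [min_eq_left h] using (Nat.lt_floor_add_one (x c * m)).le
  · have hlast : ((m - 1 : ℕ) : ℝ) + 1 = m := by exact_mod_cast Nat.sub_add_cancel hm
    simp only [min_eq_right h, hlast]
    exact mul_le_of_le_one_left hm'.le (hx c).2

theorem dist_le_of_mem_cell (hx : x ∈ cell m p) (hy : y ∈ cell m p) : dist x y ≤ 2 / m := by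
  have hc : ∀ c, dist (x c) (y c) ^ 2 ≤ (1 / (m : ℝ)) ^ 2 := fun c => by
    refine pow_le_pow_left₀ dist_nonneg ((Real.dist_le_of_mem_Icc (hx c) (hy c)).trans_eq ?_) 2
    ring
  rw [EuclideanSpace.dist_eq, Fin.sum_univ_two]
  refine Real.sqrt_le_iff.2 ⟨by positivity, ?_⟩
  have : (2 / (m : ℝ)) ^ 2 = 4 * (1 / (m : ℝ)) ^ 2 := by ring
  linarith [hc 0, hc 1, sq_nonneg (1 / (m : ℝ))]

theorem half_le_dist_of_mem_cell (hm : 4 ≤ m) (hp : (p 0 : ℕ) = 0) (hq : (q 0 : ℕ) = m - 1)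
    (hx : x ∈ cell m p) (hy : y ∈ cell m q) : 1 / 2 ≤ dist x y := by
  have hm' : (4 : ℝ) ≤ m := by exact_mod_cast hm
  have hleft : x 0 ≤ 1 / m := by simpa [hp] using (hx 0).2
  have hright : 1 - 1 / (m : ℝ) ≤ y 0 := by
    have := (hy 0).1
    rwa [hq, Nat.cast_sub (by omega), Nat.cast_one, sub_div, div_self (by positivity)] at this
  have hside : 1 / (m : ℝ) ≤ 1 / 4 := one_div_le_one_div_of_le (by norm_num) hm'
  calc 1 / 2 ≤ |x 0 - y 0| := by linarith [neg_le_abs (x 0 - y 0)]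
    _ ≤ dist x y := by
      rw [dist_eq_norm]
      simpa using PiLp.norm_apply_le (x - y) 0

end Grid

variable {n k : ℕ}

section Dynamics

variable {R : Radio} {keep : ReceptionRule n} {x : Fin n → Plane} {h₀ : Holdings n k}
  {a : ℕ → Action n k} {c : Fin k} {s : Fin n} {r : ℝ}

theorem IsLink.unique (hx : ∀ i j l, i ≠ j → l ≠ j → dist (x i) (x j) ≠ dist (x i) (x l))
    {b : Action n k} {i j l : Fin n} (hj : IsLink x b i j) (hl : IsLink x b i l) : j = l := by
  by_contra hne
  have hij : i ≠ j := fun h => hj.1 (h ▸ hj.2.1)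
  exact hx i j l hij (Ne.symm hne) (le_antisymm (hj.2.2 l hl.2.1) (hl.2.2 j hj.2.1))

theorem Radio.holdings_mono (R : Radio) (keep : ReceptionRule n) (x : Fin n → Plane)
    (h₀ : Holdings n k) (a : ℕ → Action n k) (i : Fin n) :
    Monotone fun t => R.holdings keep x h₀ a t i :=
  monotone_nat_of_le_succ fun _ => Finset.subset_union_left

theorem Radio.mem_holdings_floor_of_spreadTime_le {B : ℝ}
    (h : (R.spreadTime keep x h₀ a c : ℝ≥0∞) ≤ ENNReal.ofReal B) (i : Fin n) :
    c ∈ R.holdings keep x h₀ a ⌊B⌋₊ i := by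
  suffices hlt : R.spreadTime keep x h₀ a c < (⌊B⌋₊ + 1 : ℕ) by
    simp only [Radio.spreadTime, iInf_lt_iff] at hlt
    obtain ⟨t, ht, htB⟩ := hlt
    exact R.holdings_mono keep x h₀ a i (Nat.le_of_lt_succ (by exact_mod_cast htB)) (ht i)
  have hBlt : ENNReal.ofReal B < ((⌊B⌋₊ + 1 : ℕ) : ℝ≥0∞) := by
    rw [← ENNReal.ofReal_natCast, ENNReal.ofReal_lt_ofReal_iff (by positivity)]
    exact_mod_cast Nat.lt_floor_add_one B
  rw [← ENat.toENNReal_lt]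
  exact_mod_cast h.trans_lt hBlt

open Classical in
/-- The nodes reached from the node `s` by successive transmissions of the message `c` over links
of length at most `r`. The SINR is ignored, so this bounds from above the set of nodes that possess
`c` as long as `c` is never sent over a longer link. -/
noncomputable def shortReach (r : ℝ) (x : Fin n → Plane) (a : ℕ → Action n k) (c : Fin k)
    (s : Fin n) : ℕ → Finset (Fin n)
  | 0 => {s}
  | t + 1 => shortReach r x a c s t ∪ Finset.univ.filter fun j =>
      ∃ i ∈ shortReach r x a c s t, a t i = some c ∧ IsLink x (a t) i j ∧ dist (x i) (x j) ≤ r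

theorem mem_shortReach_of_mem_holdings (hkeep : ∀ j s, keep j s ⊆ s)
    (hs : ∀ i, c ∈ h₀ i → i = s)
    (ha : ∀ u i, a u i = some c → c ∈ R.holdings keep x h₀ a u i) {t : ℕ}
    (hr : ∀ u < t, ∀ i j, a u i = some c → IsLink x (a u) i j → dist (x i) (x j) ≤ r) {j : Fin n}
    (hj : c ∈ R.holdings keep x h₀ a t j) : j ∈ shortReach r x a c s t := by
  classical
  induction t generalizing j with
  | zero => exact Finset.mem_singleton.2 (hs j hj)
  | succ t ih =>
    have ih' : ∀ {i}, c ∈ R.holdings keep x h₀ a t i → i ∈ shortReach r x a c s t :=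
      ih fun u hu => hr u (hu.trans t.lt_succ_self)
    rcases Finset.mem_union.1 hj with hj | hj
    · exact Finset.mem_union_left _ (ih' hj)
    · obtain ⟨i, hi, hic⟩ := Finset.mem_biUnion.1 hj
      have hlink : IsLink x (a t) i j := (Finset.mem_filter.1 (hkeep _ _ hi)).2.1
      have hsend : a t i = some c := by simpa only [Option.mem_toFinset, Option.mem_def] using hic
      exact Finset.mem_union_right _ (Finset.mem_filter.2 ⟨Finset.mem_univ j, i,
        ih' (ha t i hsend), hsend, hlink, hr t t.lt_succ_self i j hsend hlink⟩)

theorem exists_far_mem_shortReach (hkeep : ∀ j s, keep j s ⊆ s) (hs : ∀ i, c ∈ h₀ i → i = s)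
    (ha : ∀ u i, a u i = some c → c ∈ R.holdings keep x h₀ a u i) {t : ℕ}
    (hr : ∀ u < t, ∀ i j, a u i = some c → IsLink x (a u) i j → dist (x i) (x j) ≤ r)
    (hall : ∀ i, c ∈ R.holdings keep x h₀ a t i) {D : ℝ} {i j : Fin n}
    (hij : D ≤ dist (x i) (x j)) : ∃ l ∈ shortReach r x a c s t, D / 2 ≤ dist (x s) (x l) := by
  have hreach : ∀ l, l ∈ shortReach r x a c s t := fun l =>
    mem_shortReach_of_mem_holdings hkeep hs ha hr (hall l)
  by_contra! hnear
  linarith [hnear i (hreach i), hnear j (hreach j), dist_triangle_left (x i) (x j) (x s)]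

end Dynamics

section Potential

variable {l r : ℝ} {x : Fin n → Plane} {a : ℕ → Action n k} {c : Fin k} {s : Fin n} {t : ℕ}

/-- The weight of a node in the exponential potential: `exp (l * d)`, where `d` is its distance to
the node `s`. -/
noncomputable def distWeight (l : ℝ) (x : Fin n → Plane) (s j : Fin n) : ℝ≥0∞ :=
  ENNReal.ofReal (Real.exp (l * dist (x s) (x j)))

/-- The exponential potential of the nodes reached from `s`. Its expectation grows slowly, while a
single far node makes it large. -/
noncomputable def potential (l r : ℝ) (x : Fin n → Plane) (a : ℕ → Action n k) (c : Fin k)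
    (s : Fin n) (t : ℕ) : ℝ≥0∞ :=
  ∑ j ∈ shortReach r x a c s t, distWeight l x s j

theorem distWeight_le_exp_mul (hl : 0 ≤ l) {i j : Fin n} (hij : dist (x i) (x j) ≤ r) :
    distWeight l x s j ≤ ENNReal.ofReal (Real.exp (l * r)) * distWeight l x s i := by
  rw [distWeight, distWeight, ← ENNReal.ofReal_mul (Real.exp_nonneg _), ← Real.exp_add, ← mul_add]
  gcongr
  linarith [dist_triangle (x s) (x i) (x j)]

theorem potential_succ_le (hl : 0 ≤ l)
    (hlink : ∀ i j j', IsLink x (a t) i j → IsLink x (a t) i j' → j = j') :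
    potential l r x a c s (t + 1) ≤ potential l r x a c s t + ENNReal.ofReal (Real.exp (l * r)) *
      ∑ i ∈ (shortReach r x a c s t).filter fun i => a t i = some c, distWeight l x s i := by
  classical
  set J := shortReach r x a c s t
  set N := Finset.univ.filter fun j =>
    ∃ i ∈ J, a t i = some c ∧ IsLink x (a t) i j ∧ dist (x i) (x j) ≤ r
  have hnew : ∀ j ∈ N, ∃ i ∈ J, a t i = some c ∧ IsLink x (a t) i j ∧ dist (x i) (x j) ≤ r :=
    fun j hj => (Finset.mem_filter.1 hj).2
  choose! sender hJ hsend hsl hr using hnew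
  -- A sender has only one receiver, so it is charged for at most one new node.
  have hinj : Set.InjOn sender N := fun j hj j' hj' h =>
    hlink _ _ _ (hsl j hj) (h ▸ hsl j' hj')
  calc potential l r x a c s (t + 1)
      ≤ ∑ j ∈ J, distWeight l x s j + ∑ j ∈ N, distWeight l x s j := by
        rw [← Finset.sum_union_inter]
        exact le_self_add
    _ ≤ potential l r x a c s t +
          ∑ j ∈ N, ENNReal.ofReal (Real.exp (l * r)) * distWeight l x s (sender j) :=
        add_le_add le_rfl (Finset.sum_le_sum fun j hj => distWeight_le_exp_mul hl (hr j hj))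
    _ ≤ _ := by
        rw [← Finset.mul_sum, ← Finset.sum_image hinj]
        gcongr
        exact Finset.image_subset_iff.2 fun j hj => Finset.mem_filter.2 ⟨hJ j hj, hsend j hj⟩

theorem exp_le_potential (hl : 0 ≤ l) {j : Fin n} (hj : j ∈ shortReach r x a c s t) {D : ℝ}
    (hD : D ≤ dist (x s) (x j)) : ENNReal.ofReal (Real.exp (l * D)) ≤ potential l r x a c s t :=
  calc ENNReal.ofReal (Real.exp (l * D)) ≤ distWeight l x s j := by unfold distWeight; gcongr
    _ ≤ potential l r x a c s t := Finset.single_le_sum (fun _ _ => zero_le) hj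

end Potential

section Measurability

variable {Ω : Type*} {m : MeasurableSpace Ω} {X : Fin n → Ω → Plane} {t : ℕ}

theorem measurable_isLink {b : Ω → Action n k} (hX : ∀ i, Measurable (X i))
    (hb : Measurable[m, ⊤] b) (i j : Fin n) :
    Measurable fun ω => IsLink (fun l => X l ω) (b ω) i j := by
  have hact : ∀ p : Action n k → Prop, Measurable fun ω => p (b ω) := fun p =>
    measurable_from_top.comp hb
  refine (hact fun b => b i ≠ none).and ((hact fun b => b j = none).and (.forall fun l =>
    (hact fun b => b l = none).imp (measurableSet_setOfPred.1 ?_)))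
  exact measurableSet_le ((hX i).dist (hX j)) ((hX i).dist (hX l))

theorem measurable_mem_shortReach {a : Ω → ℕ → Action n k} (hX : ∀ i, Measurable (X i))
    (ha : ∀ u < t, Measurable[m, ⊤] fun ω => a ω u) (r : ℝ) (c : Fin k) (s j : Fin n) :
    Measurable fun ω => j ∈ shortReach r (fun l => X l ω) (a ω) c s t := by
  induction t generalizing j with
  | zero => exact measurable_const
  | succ t ih =>
    simp only [shortReach, Finset.mem_union, Finset.mem_filter_univ]
    have ih' := ih fun u hu => ha u (hu.trans t.lt_succ_self)
    have hat := ha t t.lt_succ_self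
    have hsend : ∀ i, Measurable fun ω => a ω t i = some c := fun i =>
      (measurable_from_top (f := fun b : Action n k => b i = some c)).comp hat
    refine (ih' j).or (.exists fun i => (ih' i).and ((hsend i).and
      ((measurable_isLink hX hat i j).and (measurableSet_setOfPred.1 ?_))))
    exact measurableSet_le ((hX i).dist (hX j)) measurable_const

theorem measurable_distWeight (hX : ∀ i, Measurable (X i)) (l : ℝ) (s j : Fin n) :
    Measurable fun ω => distWeight l (fun i => X i ω) s j :=
  (by fun_prop : Measurable fun d : ℝ => ENNReal.ofReal (Real.exp (l * d))).comp
    ((hX s).dist (hX j))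

theorem measurable_ite_mem_shortReach {a : Ω → ℕ → Action n k} (hX : ∀ i, Measurable (X i))
    (ha : ∀ u < t, Measurable[m, ⊤] fun ω => a ω u) (l r : ℝ) (c : Fin k) (s j : Fin n) :
    Measurable fun ω => if j ∈ shortReach r (fun i => X i ω) (a ω) c s t then
      distWeight l (fun i => X i ω) s j else 0 :=
  Measurable.ite (measurableSet_setOfPred.2 (measurable_mem_shortReach hX ha r c s j))
    (measurable_distWeight hX l s j) measurable_const

end Measurability

section Estimates

/-- The number of cells along each side of the square. It is of order `√(n / log n)`, the largest
order for which every cell contains, with high probability, a receiver in every slot; with the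
factor `1 / 4` a given cell fails to do so with probability at most `n ^ (-8)`. -/
noncomputable def gridSize (n : ℕ) : ℕ := ⌊√(n / Real.log n) / 4⌋₊

theorem mul_log_le_sqrt_div_log {C : ℝ} (hL : 0 < Real.log n) (h : C ^ 2 * Real.log n ^ 3 ≤ n) :
    C * Real.log n ≤ √(n / Real.log n) := by
  refine Real.le_sqrt_of_sq_le ((le_div_iff₀ hL).2 ?_)
  linarith

theorem gridSize_le (n : ℕ) : (gridSize n : ℝ) ≤ √(n / Real.log n) / 4 :=
  Nat.floor_le (by positivity)

theorem le_gridSize (h : 8 ≤ √(n / Real.log n)) : √(n / Real.log n) / 8 ≤ gridSize n := by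
  have := Nat.lt_floor_add_one (√(n / Real.log n) / 4)
  rw [← gridSize] at this
  linarith

theorem four_le_gridSize (hL : 1 ≤ Real.log n) (hcube : 512 ^ 2 * Real.log n ^ 3 ≤ n) :
    4 ≤ gridSize n := by
  have hlog := mul_log_le_sqrt_div_log (one_pos.trans_le hL) hcube
  have := le_gridSize (n := n) (by linarith)
  exact_mod_cast (by linarith : (4 : ℝ) ≤ gridSize n)

theorem gridSize_sq_mul_log_le (hL : 0 < Real.log n) :
    (gridSize n : ℝ) ^ 2 * Real.log n ≤ n / 16 := by
  calc (gridSize n : ℝ) ^ 2 * Real.log n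
      ≤ (√(n / Real.log n) / 4) ^ 2 * Real.log n := by
        gcongr
        exact gridSize_le n
    _ = (n : ℝ) / 16 := by
        rw [div_pow, Real.sq_sqrt (by positivity)]
        field_simp
        norm_num

theorem exp_neg_mul_log (hn : 0 < n) (j : ℕ) :
    Real.exp (-(j * Real.log n)) = ((n : ℝ) ^ j)⁻¹ := by
  rw [Real.exp_neg, Real.exp_nat_mul, Real.exp_log (by exact_mod_cast hn)]

theorem one_sub_pow_le_inv_pow (hn : 0 < n) {q : ℝ} (hq : q ≤ 1) {j : ℕ}
    (h : j * Real.log n ≤ n * q) : (1 - q) ^ n ≤ ((n : ℝ) ^ j)⁻¹ := by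
  calc (1 - q) ^ n ≤ Real.exp (-q) ^ n := by
        have := sub_nonneg.2 hq
        gcongr
        exact Real.one_sub_le_exp_neg q
    _ ≤ Real.exp (-(j * Real.log n)) := by
        rw [← Real.exp_nat_mul]
        gcongr
        linarith
    _ = ((n : ℝ) ^ j)⁻¹ := exp_neg_mul_log hn j

theorem one_sub_div_gridSize_sq_pow_le (hL : 0 < Real.log n) (hm : 1 ≤ gridSize n) {q : ℝ}
    (hq : 1 / 2 ≤ q) (hq1 : q ≤ 1) : (1 - q / gridSize n ^ 2) ^ n ≤ ((n : ℝ) ^ 8)⁻¹ := by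
  have hm1 : (1 : ℝ) ≤ (gridSize n : ℝ) ^ 2 := one_le_pow₀ (by exact_mod_cast hm)
  have hn : 0 < n := Nat.pos_of_ne_zero fun h => by simp [h] at hL
  refine one_sub_pow_le_inv_pow hn (div_le_one_of_le₀ (hq1.trans hm1) (by positivity)) ?_
  rw [mul_div_assoc', le_div_iff₀ (by positivity)]
  push_cast
  calc 8 * Real.log n * (gridSize n : ℝ) ^ 2 ≤ n * (1 / 2) := by
        linarith [gridSize_sq_mul_log_le hL]
    _ ≤ n * q := by gcongr

theorem exp_neg_mul_one_add_exp_div_pow_le {w T : ℕ} (hn : 0 < n) (hw : 0 < w)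
    (hlog : 512 * Real.log n ≤ √(n / Real.log n)) (h8 : 8 ≤ √(n / Real.log n))
    (hT : (T : ℝ) ≤ w / 512 * √(n / Real.log n)) :
    Real.exp (-(gridSize n / 8)) * (1 + Real.exp 1 / w) ^ T ≤ ((n : ℝ) ^ 4)⁻¹ := by
  have hgrowth : T * (Real.exp 1 / w) ≤ 3 / 512 * √(n / Real.log n) := by
    calc T * (Real.exp 1 / w) ≤ w / 512 * √(n / Real.log n) * (3 / w) := by
          gcongr
          linarith [Real.exp_one_lt_d9]
      _ = 3 / 512 * √(n / Real.log n) := by field_simp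
  calc Real.exp (-(gridSize n / 8)) * (1 + Real.exp 1 / w) ^ T
      ≤ Real.exp (-(gridSize n / 8)) * Real.exp (Real.exp 1 / w) ^ T := by
        gcongr
        rw [add_comm]
        exact Real.add_one_le_exp _
    _ = Real.exp (-(gridSize n / 8) + T * (Real.exp 1 / w)) := by
        rw [← Real.exp_nat_mul, Real.exp_add]
    _ ≤ Real.exp (-((4 : ℕ) * Real.log n)) := by
        gcongr
        push_cast
        -- With `s = √(n / log n)`, the exponent is at most `3 * s / 512 - s / 64 = -5 * s / 512`.
        linarith [le_gridSize h8]
    _ = ((n : ℝ) ^ 4)⁻¹ := exp_neg_mul_log hn 4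

theorem mul_gridSize_sq_mul_div_le {w T : ℕ} (hL : 1 ≤ Real.log n) (hw : 0 < w)
    (hT : (T : ℝ) ≤ w / 512 * √(n / Real.log n)) :
    T * ((gridSize n : ℝ) ^ 2 * (n * (1 / w))) ≤ n ^ 3 := by
  have hn : 1 ≤ (n : ℝ) := by
    exact_mod_cast Nat.pos_of_ne_zero fun h => by norm_num [h] at hL
  have hsqrt : √(n / Real.log n) ≤ n := by
    refine Real.sqrt_le_iff.2 ⟨by positivity, (div_le_self (by positivity) hL).trans ?_⟩
    exact le_self_pow₀ hn two_ne_zero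
  have hsq : (gridSize n : ℝ) ^ 2 ≤ n := by
    nlinarith [gridSize_sq_mul_log_le (one_pos.trans_le hL), sq_nonneg (gridSize n : ℝ)]
  calc T * ((gridSize n : ℝ) ^ 2 * (n * (1 / w)))
      ≤ w / 512 * n * (n * (n * (1 / w))) := by
        gcongr
        exact hT.trans (by gcongr)
    _ = (n : ℝ) ^ 3 / 512 := by field_simp
    _ ≤ n ^ 3 := div_le_self (by positivity) (by norm_num)

theorem union_bound_lt_inv_sq {w T : ℕ} {θ : ℝ} (hθ0 : 0 ≤ θ) (hθ : θ ≤ 1 / 2) (hL : 1 ≤ Real.log n)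
    (hcube : 512 ^ 2 * Real.log n ^ 3 ≤ n) (hw : 0 < w)
    (hT : (T : ℝ) ≤ w / 512 * √(n / Real.log n)) :
    2 * (1 - 1 / (gridSize n : ℝ) ^ 2) ^ n +
        T * (gridSize n ^ 2 * (n * (1 / w * (1 - (1 - θ) / gridSize n ^ 2) ^ n))) +
        n * (Real.exp (-(gridSize n / 8)) * (1 + Real.exp 1 / w) ^ T) < ((n : ℝ) ^ 2)⁻¹ := by
  have hL0 : 0 < Real.log n := by linarith
  have hn : (2 : ℝ) ≤ n := by nlinarith [one_le_pow₀ (n := 3) hL]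
  have hn0 : 0 < n := by exact_mod_cast two_pos.trans_le hn
  have hlog := mul_log_le_sqrt_div_log hL0 hcube
  have hm : 1 ≤ gridSize n := le_trans (by norm_num) (four_le_gridSize hL hcube)
  have hempty := one_sub_div_gridSize_sq_pow_le hL0 hm (q := 1) (by norm_num) le_rfl
  have hjam := one_sub_div_gridSize_sq_pow_le hL0 hm (q := 1 - θ) (by linarith) (by linarith)
  have hfar := exp_neg_mul_one_add_exp_div_pow_le hn0 hw hlog (by linarith) hT
  calc _ = 2 * (1 - 1 / (gridSize n : ℝ) ^ 2) ^ n +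
        T * (gridSize n ^ 2 * (n * (1 / w))) * (1 - (1 - θ) / gridSize n ^ 2) ^ n +
        n * (Real.exp (-(gridSize n / 8)) * (1 + Real.exp 1 / w) ^ T) := by ring
    _ ≤ 2 * ((n : ℝ) ^ 8)⁻¹ + n ^ 3 * ((n : ℝ) ^ 8)⁻¹ + n * ((n : ℝ) ^ 4)⁻¹ := by
        have htransmit := mul_gridSize_sq_mul_div_le hL hw hT
        grw [hempty, hjam, htransmit, hfar]
    _ = ((n : ℝ) ^ 2)⁻¹ * (2 / n ^ 6 + 1 / n ^ 3 + 1 / n) := by field_simp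
    _ ≤ ((n : ℝ) ^ 2)⁻¹ * (2 / 2 ^ 6 + 1 / 2 ^ 3 + 1 / 2) := by gcongr
    _ < ((n : ℝ) ^ 2)⁻¹ := mul_lt_of_lt_one_right (by positivity) (by norm_num)

theorem eventually_mul_log_pow_le (C : ℝ) (j : ℕ) :
    ∀ᶠ n : ℕ in atTop, C * Real.log n ^ j ≤ n := by
  have h := ((Real.isLittleO_pow_log_id_atTop (n := j)).const_mul_left C).comp_tendsto
    (tendsto_natCast_atTop_atTop (R := ℝ))
  filter_upwards [h.bound one_pos] with n hn
  simpa using (Real.le_norm_self _).trans hn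

theorem rpow_one_sub_mul_sqrt_le {w ε x L : ℝ} (hw : 0 < w) (hx : 0 ≤ x) (hL : 0 ≤ L)
    (hwε : 512 ≤ w ^ ε) : w ^ (1 - ε) * √(x / (128 * L)) ≤ w / 512 * √(x / L) := by
  rw [Real.rpow_sub hw, Real.rpow_one]
  gcongr ?_ * √?_
  · gcongr
  · rw [mul_comm, ← div_div]
    exact div_le_self (by positivity) (by norm_num)

theorem SuperPolylog.tendsto_atTop {w : ℕ → ℕ} (hw : SuperPolylog w) :
    Tendsto w atTop atTop := by
  rw [← tendsto_natCast_atTop_iff (R := ℝ)]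
  refine tendsto_atTop_mono' atTop ?_ (Real.tendsto_log_atTop.comp tendsto_natCast_atTop_atTop)
  filter_upwards [(hw 1).bound one_pos] with n hn
  simpa using (Real.le_norm_self _).trans hn

end Estimates

section PushProb

variable {θ : ℝ}

theorem pushProb_nonneg (h0 : 0 ≤ θ) (h1 : θ ≤ 1) (s : Finset (Fin k)) (b : Option (Fin k)) :
    0 ≤ pushProb θ s b := by
  cases b with
  | none => simpa [pushProb] using h1
  | some c => simp only [pushProb, Option.elim]; positivity

theorem sum_pushProb_some_le (h0 : 0 ≤ θ) (s : Finset (Fin k)) :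
    ∑ c, pushProb θ s (some c) ≤ θ := by
  simp only [pushProb, Option.elim, Finset.sum_ite_mem, Finset.univ_inter, Finset.sum_const,
    nsmul_eq_mul]
  rcases s.eq_empty_or_nonempty with rfl | hs
  · simpa using h0
  · exact (mul_div_cancel₀ θ (Nat.cast_ne_zero.2 hs.card_ne_zero)).le

theorem sum_pushProb_le_one (h0 : 0 ≤ θ) (s : Finset (Fin k)) : ∑ b, pushProb θ s b ≤ 1 := by
  have hnone : pushProb θ s none = 1 - θ := rfl
  rw [Fintype.sum_option, hnone]
  linarith [sum_pushProb_some_le h0 s]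

theorem pushProb_some_le (h0 : 0 ≤ θ) {w : ℕ} (hw : 0 < w) {s : Finset (Fin k)}
    (hs : w ≤ s.card) (c : Fin k) : pushProb θ s (some c) ≤ θ / w := by
  simp only [pushProb, Option.elim]
  split_ifs
  · gcongr
  · positivity

theorem sum_filter_pushProb_le (h0 : 0 ≤ θ) (h1 : θ ≤ 1) {w : ℕ} (hw : 0 < w)
    {s : Finset (Fin k)} (hs : w ≤ s.card) (c : Fin k) (p q : Prop) [Decidable p] [Decidable q] :
    ∑ b with (p → b = some c) ∧ (q → b ≠ none), pushProb θ s b ≤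
      (if p then 1 / (w : ℝ) else 1) * if q then θ else 1 := by
  have hsub : ∀ {A B : Finset (Option (Fin k))}, A ⊆ B →
      ∑ b ∈ A, pushProb θ s b ≤ ∑ b ∈ B, pushProb θ s b := fun h =>
    Finset.sum_le_sum_of_subset_of_nonneg h fun b _ _ => pushProb_nonneg h0 h1 s b
  by_cases hp : p
  · calc _ ≤ ∑ b ∈ {some c}, pushProb θ s b :=
          hsub fun b hb => Finset.mem_singleton.2 ((Finset.mem_filter.1 hb).2.1 hp)
      _ ≤ 1 / w * θ := by
          rw [Finset.sum_singleton, one_div_mul_eq_div]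
          exact pushProb_some_le h0 hw hs c
      _ ≤ _ := by
          rw [if_pos hp]
          gcongr
          split_ifs
          exacts [le_rfl, h1]
  · rw [if_neg hp, one_mul]
    by_cases hq : q
    · rw [if_pos hq]
      calc _ ≤ ∑ b ∈ Finset.univ.map .some, pushProb θ s b := hsub fun b hb => by
            have := (Finset.mem_filter.1 hb).2.2 hq
            simpa [Option.ne_none_iff_exists] using this
        _ ≤ θ := by
            rw [Finset.sum_map]
            exact sum_pushProb_some_le h0 s
    · rw [if_neg hq]
      exact (hsub (Finset.subset_univ _)).trans (sum_pushProb_le_one h0 s)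

end PushProb

section PushDynamics

variable {Ω : Type*} [mΩ : MeasurableSpace Ω] {μ : Measure Ω} {R : Radio}
  {keep : ReceptionRule n} {ℱ : Filtration ℕ mΩ} {X : Fin n → Ω → Plane}
  {H₀ : Ω → Holdings n k} {act : ℕ → Ω → Action n k}

/-- The random holdings of the nodes at the beginning of slot `t`. -/
noncomputable abbrev pastHoldings (R : Radio) (keep : ReceptionRule n) (X : Fin n → Ω → Plane)
    (H₀ : Ω → Holdings n k) (act : ℕ → Ω → Action n k) (t : ℕ) (ω : Ω) : Holdings n k :=
  R.holdings keep (fun l => X l ω) (H₀ ω) (fun s => act s ω) t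

namespace IsRandomPush

theorem measurable_act_top (hP : IsRandomPush μ R keep ℱ X H₀ act) (t : ℕ) :
    Measurable[ℱ (t + 1), ⊤] (act t) :=
  @measurable_to_countable' _ _ ⊤ _ (ℱ (t + 1)) _ (hP.measurable_act t)

theorem measurableSet_act (hP : IsRandomPush μ R keep ℱ X H₀ act) (t : ℕ)
    (p : Action n k → Prop) : MeasurableSet {ω | p (act t ω)} :=
  ℱ.le (t + 1) _ (hP.measurable_act_top t (trivial : MeasurableSet[⊤] {a | p a}))

theorem measurable_loc_at (hP : IsRandomPush μ R keep ℱ X H₀ act) (t : ℕ) (i : Fin n) :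
    Measurable[ℱ t] (X i) :=
  (hP.measurable_loc i).mono (ℱ.mono (Nat.zero_le t)) le_rfl

theorem measurable_loc_ambient (hP : IsRandomPush μ R keep ℱ X H₀ act) (i : Fin n) :
    Measurable (X i) :=
  (hP.measurable_loc i).mono (ℱ.le 0) le_rfl

section Locations

theorem ae_mem_unitSquare (hP : IsRandomPush μ R keep ℱ X H₀ act) :
    ∀ᵐ ω ∂μ, ∀ i, X i ω ∈ unitSquare := by
  refine ae_all_iff.2 fun i => ?_
  refine ae_of_ae_map (p := fun y => y ∈ unitSquare) (hP.measurable_loc_ambient i).aemeasurable ?_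
  rw [hP.uniform_loc i]
  exact ae_restrict_mem measurableSet_unitSquare

theorem measureReal_loc_preimage (hP : IsRandomPush μ R keep ℱ X H₀ act) {Q : Set Plane}
    (hQ : MeasurableSet Q) (i : Fin n) :
    μ.real (X i ⁻¹' Q) = (volume.restrict unitSquare).real Q := by
  rw [← hP.uniform_loc i, map_measureReal_apply (hP.measurable_loc_ambient i) hQ]

theorem ae_dist_ne [IsProbabilityMeasure μ] (hP : IsRandomPush μ R keep ℱ X H₀ act) :
    ∀ᵐ ω ∂μ, ∀ i j l, i ≠ j → l ≠ j → dist (X i ω) (X j ω) ≠ dist (X i ω) (X l ω) := by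
  refine ae_all_iff.2 fun i => ae_all_iff.2 fun j => ae_all_iff.2 fun l => ?_
  by_cases hij : i = j
  · exact ae_of_all _ fun _ h => absurd hij h
  by_cases hlj : l = j
  · exact ae_of_all _ fun _ _ h => absurd hlj h
  have hX := hP.measurable_loc_ambient
  have hind : IndepFun (fun ω => (X i ω, dist (X i ω) (X l ω))) (X j) μ :=
    (hP.indep_loc.indepFun_prodMk hX i l j hij hlj).comp
      (φ := fun z : Plane × Plane => (z.1, dist z.1 z.2)) (by fun_prop) measurable_id
  have hac : μ.map (X j) ≪ volume := by
    rw [hP.uniform_loc j]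
    exact Measure.absolutelyContinuous_of_le Measure.restrict_le_self
  filter_upwards [ae_dist_ne_of_indepFun (hX i) ((hX i).dist (hX l)) (hX j) hind hac]
    with ω hω _ _ using hω

theorem measureReal_forall_notMem [IsProbabilityMeasure μ]
    (hP : IsRandomPush μ R keep ℱ X H₀ act) {Q : Set Plane} (hQ : MeasurableSet Q) :
    μ.real {ω | ∀ i, X i ω ∉ Q} = (1 - (volume.restrict unitSquare).real Q) ^ n := by
  simpa using measureReal_forall_mem_iff hP.indep_loc hP.measurable_loc_ambient hQ
    (hP.measureReal_loc_preimage hQ) ∅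

end Locations

section Actions

variable [IsProbabilityMeasure μ] {w : ℕ}

theorem condExp_forall_act_mem (hP : IsRandomPush μ R keep ℱ X H₀ act) (t : ℕ)
    (B : Fin n → Finset (Option (Fin k))) :
    μ⟦{ω | ∀ i, act t ω i ∈ B i} | ℱ t⟧ =ᵐ[μ] fun ω =>
      ∏ i, ∑ b ∈ B i, pushProb R.sendProb (pastHoldings R keep X H₀ act t ω i) b := by
  classical
  have hdecomp : {ω | ∀ i, act t ω i ∈ B i}.indicator (fun _ => (1 : ℝ)) =
      ∑ a ∈ Fintype.piFinset B, {ω | act t ω = a}.indicator fun _ => (1 : ℝ) := by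
    ext ω
    simp [Finset.sum_apply, Set.indicator_apply]
  have hint : ∀ a, Integrable ({ω | act t ω = a}.indicator fun _ => (1 : ℝ)) μ := fun a =>
    (integrable_const 1).indicator (hP.measurableSet_act t (· = a))
  rw [hdecomp]
  filter_upwards [condExp_finsetSum (fun a _ => hint a) (ℱ t),
    ae_all_iff.2 fun a => hP.cond_act t a] with ω hsum hact
  rw [hsum, Finset.sum_apply, Finset.prod_univ_sum]
  exact Finset.sum_congr rfl fun a _ => hact a

theorem ae_mem_pastHoldings (hP : IsRandomPush μ R keep ℱ X H₀ act) :
    ∀ᵐ ω ∂μ, ∀ t i c, act t ω i = some c → c ∈ pastHoldings R keep X H₀ act t ω i := by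
  filter_upwards [ae_all_iff.2 fun t => ae_all_iff.2 fun a => hP.cond_act t a,
    ae_all_iff.2 fun t => ae_all_iff.2 fun a => ae_condExp_indicator_ne_zero (μ := μ) (ℱ.le t)
      (hP.measurableSet_act t (· = a))] with ω hprod hne t i c hsend
  have hpos := hne t (act t ω) rfl
  rw [hprod] at hpos
  have hfactor := Finset.prod_ne_zero_iff.1 hpos i (Finset.mem_univ i)
  rw [hsend] at hfactor
  by_contra hmem
  exact hfactor (if_neg hmem)

theorem condExp_transmits_le (hP : IsRandomPush μ R keep ℱ X H₀ act) (hw : 0 < w)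
    (hH : ∀ᵐ ω ∂μ, ∀ i, w ≤ (H₀ ω i).card) (t : ℕ) (i : Fin n) (c : Fin k) (S : Finset (Fin n)) :
    ∀ᵐ ω ∂μ, (μ⟦{ω | act t ω i = some c ∧ ∀ l ∈ S, act t ω l ≠ none} | ℱ t⟧) ω ≤
      1 / w * R.sendProb ^ S.card := by
  classical
  have h0 := R.sendProb_pos.le
  have h1 : R.sendProb ≤ 1 := by linarith [R.sendProb_lt]
  let B : Fin n → Finset (Option (Fin k)) := fun l =>
    {b | (l = i → b = some c) ∧ (l ∈ S → b ≠ none)}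
  have hset : {ω | act t ω i = some c ∧ ∀ l ∈ S, act t ω l ≠ none} =
      {ω | ∀ l, act t ω l ∈ B l} := by
    ext ω
    simp [B, forall_and]
  rw [hset]
  filter_upwards [hP.condExp_forall_act_mem t B, hH] with ω hprod hω
  have hcard : ∀ l, w ≤ (pastHoldings R keep X H₀ act t ω l).card := fun l =>
    (hω l).trans (Finset.card_le_card (R.holdings_mono keep _ _ _ l (Nat.zero_le t)))
  rw [hprod]
  calc ∏ l, ∑ b ∈ B l, pushProb R.sendProb (pastHoldings R keep X H₀ act t ω l) b
      ≤ ∏ l, (if l = i then 1 / (w : ℝ) else 1) * if l ∈ S then R.sendProb else 1 :=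
        Finset.prod_le_prod
          (fun l _ => Finset.sum_nonneg fun _ _ => pushProb_nonneg h0 h1 _ _)
          fun l _ => sum_filter_pushProb_le h0 h1 hw (hcard l) c (l = i) (l ∈ S)
    _ = 1 / w * R.sendProb ^ S.card := by
        rw [Finset.prod_mul_distrib, Finset.prod_ite_eq' Finset.univ i, Finset.prod_ite_mem,
          Finset.univ_inter, Finset.prod_const, if_pos (Finset.mem_univ i)]

end Actions

section LongLinks

variable [IsProbabilityMeasure μ] {w : ℕ}

theorem measureReal_transmits_inter_jammed_le (hP : IsRandomPush μ R keep ℱ X H₀ act)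
    (hw : 0 < w) (hH : ∀ᵐ ω ∂μ, ∀ i, w ≤ (H₀ ω i).card) {Q : Set Plane} (hQ : MeasurableSet Q)
    (t : ℕ) (i : Fin n) (c : Fin k) :
    μ.real {ω | act t ω i = some c ∧ ∀ l, X l ω ∈ Q → act t ω l ≠ none} ≤
      1 / w * (1 - (1 - R.sendProb) * (volume.restrict unitSquare).real Q) ^ n := by
  classical
  set p := (volume.restrict unitSquare).real Q
  let occupied : Finset (Fin n) → Set Ω := fun S => {ω | ∀ l, X l ω ∈ Q ↔ l ∈ S}
  let sending : Finset (Fin n) → Set Ω := fun S =>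
    {ω | act t ω i = some c ∧ ∀ l ∈ S, act t ω l ≠ none}
  have hocc : ∀ S, MeasurableSet[ℱ t] (occupied S) := fun S =>
    measurableSet_forall_mem_iff (hP.measurable_loc_at t) hQ (S : Set (Fin n))
  have hcover : {ω | act t ω i = some c ∧ ∀ l, X l ω ∈ Q → act t ω l ≠ none} ⊆
      ⋃ S, occupied S ∩ sending S := fun ω ⟨hi, hl⟩ =>
    Set.mem_iUnion.2 ⟨Finset.univ.filter fun l => X l ω ∈ Q, by simp [occupied], hi,
      by simpa using hl⟩
  calc μ.real {ω | act t ω i = some c ∧ ∀ l, X l ω ∈ Q → act t ω l ≠ none}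
      ≤ ∑ S, μ.real (occupied S ∩ sending S) :=
        (measureReal_mono hcover).trans (measureReal_iUnion_fintype_le _)
    _ ≤ ∑ S : Finset (Fin n), 1 / w * R.sendProb ^ S.card *
          (p ^ S.card * (1 - p) ^ (n - S.card)) := by
        refine Finset.sum_le_sum fun S _ => ?_
        refine (measureReal_inter_le_of_condExp_le (ℱ.le t) (hocc S) (hP.measurableSet_act t
          fun a => a i = some c ∧ ∀ l ∈ S, a l ≠ none)
          ((hP.condExp_transmits_le hw hH t i c S).mono fun _ h _ => h)).trans_eq ?_
        rw [measureReal_forall_mem_iff hP.indep_loc hP.measurable_loc_ambient hQ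
          (hP.measureReal_loc_preimage hQ), Fintype.card_fin]
    _ = 1 / w * ∑ S : Finset (Fin n), (R.sendProb * p) ^ S.card * (1 - p) ^ (n - S.card) := by
        rw [Finset.mul_sum]
        exact Finset.sum_congr rfl fun S _ => by ring
    _ = 1 / w * (1 - (1 - R.sendProb) * p) ^ n := by
        rw [Fin.sum_pow_mul_eq_add_pow]
        ring

theorem measureReal_exists_long_link_le (hP : IsRandomPush μ R keep ℱ X H₀ act) (hw : 0 < w)
    (hH : ∀ᵐ ω ∂μ, ∀ i, w ≤ (H₀ ω i).card) {m : ℕ} (hm : 0 < m) (T : ℕ) (c : Fin k) :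
    μ.real {ω | ∃ t < T, ∃ i j, act t ω i = some c ∧ IsLink (fun l => X l ω) (act t ω) i j ∧
      2 / m < dist (X i ω) (X j ω)} ≤
      T * (m ^ 2 * (n * (1 / w * (1 - (1 - R.sendProb) / m ^ 2) ^ n))) := by
  let jammed : ℕ → (Fin 2 → Fin m) → Fin n → Set Ω := fun t p i =>
    {ω | act t ω i = some c ∧ ∀ l, X l ω ∈ cell m p → act t ω l ≠ none}
  have hcover : ∀ᵐ ω ∂μ, (∃ t < T, ∃ i j, act t ω i = some c ∧
      IsLink (fun l => X l ω) (act t ω) i j ∧ 2 / m < dist (X i ω) (X j ω)) →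
      ω ∈ ⋃ t ∈ Finset.range T, ⋃ p, ⋃ i, jammed t p i := by
    filter_upwards [hP.ae_mem_unitSquare] with ω hω
    rintro ⟨t, ht, i, j, hsend, hlink, hlong⟩
    obtain ⟨p, hp⟩ := exists_mem_cell hm (hω i)
    refine Set.mem_biUnion (Finset.mem_range.2 ht) (Set.mem_iUnion₂.2 ⟨p, i, hsend, ?_⟩)
    exact fun l hl hrec =>
      hlong.not_ge ((hlink.2.2 l hrec).trans (dist_le_of_mem_cell hp hl))
  calc _ ≤ μ.real (⋃ t ∈ Finset.range T, ⋃ p, ⋃ i, jammed t p i) :=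
        ENNReal.toReal_mono (measure_ne_top _ _) (measure_mono_ae hcover)
    _ ≤ ∑ t ∈ Finset.range T, ∑ p, ∑ i, μ.real (jammed t p i) :=
        (measureReal_biUnion_finset_le _ _).trans <| Finset.sum_le_sum fun t _ =>
          (measureReal_iUnion_fintype_le _).trans <| Finset.sum_le_sum fun p _ =>
            measureReal_iUnion_fintype_le _
    _ ≤ ∑ _ ∈ Finset.range T, ∑ _ : Fin 2 → Fin m, ∑ _ : Fin n,
          1 / w * (1 - (1 - R.sendProb) / m ^ 2) ^ n := by
        refine Finset.sum_le_sum fun t _ => Finset.sum_le_sum fun p _ =>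
          Finset.sum_le_sum fun i _ => ?_
        refine (hP.measureReal_transmits_inter_jammed_le hw hH (measurableSet_cell m p) t i
          c).trans_eq ?_
        rw [measureReal_restrict_unitSquare_cell, mul_one_div]
    _ = _ := by simp

end LongLinks

section ExpectedPotential

variable {w : ℕ}

theorem measurable_ite_mem_shortReach (hP : IsRandomPush μ R keep ℱ X H₀ act) (t : ℕ)
    (l r : ℝ) (c : Fin k) (s j : Fin n) : Measurable[ℱ t] fun ω =>
      if j ∈ shortReach r (fun i => X i ω) (fun u => act u ω) c s t then
        distWeight l (fun i => X i ω) s j else 0 :=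
  Gossip.measurable_ite_mem_shortReach (hP.measurable_loc_at t)
    (fun u hu => (hP.measurable_act_top u).mono (ℱ.mono hu) le_rfl) l r c s j

theorem measurable_potential (hP : IsRandomPush μ R keep ℱ X H₀ act) (t : ℕ) (l r : ℝ)
    (c : Fin k) (s : Fin n) : Measurable[ℱ t] fun ω =>
      potential l r (fun i => X i ω) (fun u => act u ω) c s t := by
  have hsum : Measurable[ℱ t] fun ω => ∑ j,
      if j ∈ shortReach r (fun i => X i ω) (fun u => act u ω) c s t then
        distWeight l (fun i => X i ω) s j else 0 :=
    Finset.measurable_fun_sum _ fun j _ => hP.measurable_ite_mem_shortReach t l r c s j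
  simpa only [potential, Finset.sum_ite_mem, Finset.univ_inter] using hsum

theorem lintegral_potential_transmitters_le [IsProbabilityMeasure μ]
    (hP : IsRandomPush μ R keep ℱ X H₀ act)
    (hw : 0 < w) (hH : ∀ᵐ ω ∂μ, ∀ i, w ≤ (H₀ ω i).card) (t : ℕ) (l r : ℝ) (c : Fin k)
    (s : Fin n) :
    ∫⁻ ω, ∑ i ∈ (shortReach r (fun i => X i ω) (fun u => act u ω) c s t).filter
        fun i => act t ω i = some c, distWeight l (fun i => X i ω) s i ∂μ ≤
      ENNReal.ofReal (1 / w) *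
        ∫⁻ ω, potential l r (fun i => X i ω) (fun u => act u ω) c s t ∂μ := by
  let f : Fin n → Ω → ℝ≥0∞ := fun i ω =>
    if i ∈ shortReach r (fun i => X i ω) (fun u => act u ω) c s t then
      distWeight l (fun i => X i ω) s i else 0
  have hf : ∀ i, Measurable[ℱ t] (f i) := fun i => hP.measurable_ite_mem_shortReach t l r c s i
  have hfΩ : ∀ i, Measurable (f i) := fun i => (hf i).mono (ℱ.le t) le_rfl
  have hsend : ∀ i, MeasurableSet {ω | act t ω i = some c} := fun i =>
    hP.measurableSet_act t fun a => a i = some c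
  calc _ = ∫⁻ ω, ∑ i, {ω | act t ω i = some c}.indicator (f i) ω ∂μ := by
        refine lintegral_congr fun ω => ?_
        simp only [Set.indicator_apply, Set.mem_ofPred_eq, f, ← ite_and,
          and_comm (a := act t ω _ = some c)]
        simp only [ite_and, Finset.sum_ite_mem, Finset.univ_inter, Finset.sum_filter]
    _ = ∑ i, ∫⁻ ω in {ω | act t ω i = some c}, f i ω ∂μ := by
        rw [lintegral_finsetSum _ fun i _ => (hfΩ i).indicator (hsend i)]
        simp only [lintegral_indicator (hsend _)]
    _ ≤ ∑ i, ENNReal.ofReal (1 / w) * ∫⁻ ω, f i ω ∂μ :=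
        Finset.sum_le_sum fun i _ => setLIntegral_le_of_condExp_le (ℱ.le t) (hsend i)
          (by simpa using hP.condExp_transmits_le hw hH t i c ∅) (hf i)
    _ = ENNReal.ofReal (1 / w) *
          ∫⁻ ω, potential l r (fun i => X i ω) (fun u => act u ω) c s t ∂μ := by
        rw [← Finset.mul_sum, ← lintegral_finsetSum _ fun i _ => hfΩ i]
        simp only [f, Finset.sum_ite_mem, Finset.univ_inter, potential]

theorem ae_isLink_unique [IsProbabilityMeasure μ] (hP : IsRandomPush μ R keep ℱ X H₀ act) :
    ∀ᵐ ω ∂μ, ∀ t i j j', IsLink (fun l => X l ω) (act t ω) i j →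
      IsLink (fun l => X l ω) (act t ω) i j' → j = j' :=
  hP.ae_dist_ne.mono fun _ hω _ _ _ _ hj hj' => hj.unique hω hj'

theorem lintegral_potential_le [IsProbabilityMeasure μ] (hP : IsRandomPush μ R keep ℱ X H₀ act)
    (hw : 0 < w) (hH : ∀ᵐ ω ∂μ, ∀ i, w ≤ (H₀ ω i).card) {l : ℝ} (hl : 0 ≤ l) (r : ℝ)
    (c : Fin k) (s : Fin n) (t : ℕ) :
    ∫⁻ ω, potential l r (fun i => X i ω) (fun u => act u ω) c s t ∂μ ≤
      ENNReal.ofReal ((1 + Real.exp (l * r) / w) ^ t) := by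
  induction t with
  | zero => simp [potential, shortReach, distWeight]
  | succ t ih =>
    have hmeas : Measurable fun ω => potential l r (fun i => X i ω) (fun u => act u ω) c s t :=
      (hP.measurable_potential t l r c s).mono (ℱ.le t) le_rfl
    have hgrowth : 0 ≤ 1 + Real.exp (l * r) / w := by positivity
    calc ∫⁻ ω, potential l r (fun i => X i ω) (fun u => act u ω) c s (t + 1) ∂μ
        ≤ ∫⁻ ω, (potential l r (fun i => X i ω) (fun u => act u ω) c s t +
            ENNReal.ofReal (Real.exp (l * r)) *
              ∑ i ∈ (shortReach r (fun i => X i ω) (fun u => act u ω) c s t).filter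
                fun i => act t ω i = some c, distWeight l (fun i => X i ω) s i) ∂μ := by
          refine lintegral_mono_ae ?_
          filter_upwards [hP.ae_isLink_unique] with ω hω
          exact potential_succ_le hl (hω t)
      _ ≤ ENNReal.ofReal (1 + Real.exp (l * r) / w) *
            ∫⁻ ω, potential l r (fun i => X i ω) (fun u => act u ω) c s t ∂μ := by
          rw [lintegral_add_left hmeas, lintegral_const_mul' _ _ ENNReal.ofReal_ne_top,
            ENNReal.ofReal_add zero_le_one (by positivity), add_mul, ENNReal.ofReal_one, one_mul,
            div_eq_mul_one_div, ENNReal.ofReal_mul (Real.exp_nonneg _), mul_assoc]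
          gcongr
          exact hP.lintegral_potential_transmitters_le hw hH t l r c s
      _ ≤ ENNReal.ofReal ((1 + Real.exp (l * r) / w) ^ (t + 1)) := by
          rw [pow_succ', ENNReal.ofReal_mul hgrowth]
          gcongr

theorem measureReal_shortReach_far_le [IsProbabilityMeasure μ]
    (hP : IsRandomPush μ R keep ℱ X H₀ act) (hw : 0 < w)
    (hH : ∀ᵐ ω ∂μ, ∀ i, w ≤ (H₀ ω i).card) {l : ℝ} (hl : 0 ≤ l) (r D : ℝ) (c : Fin k)
    (s : Fin n) (t : ℕ) :
    μ.real {ω | ∃ j ∈ shortReach r (fun i => X i ω) (fun u => act u ω) c s t,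
      D ≤ dist (X s ω) (X j ω)} ≤
      Real.exp (-(l * D)) * (1 + Real.exp (l * r) / w) ^ t := by
  let φ : Ω → ℝ≥0∞ := fun ω => potential l r (fun i => X i ω) (fun u => act u ω) c s t
  have hφ : Measurable φ := (hP.measurable_potential t l r c s).mono (ℱ.le t) le_rfl
  have hfar : {ω | ∃ j ∈ shortReach r (fun i => X i ω) (fun u => act u ω) c s t,
      D ≤ dist (X s ω) (X j ω)} ⊆ {ω | ENNReal.ofReal (Real.exp (l * D)) ≤ φ ω} :=
    fun ω ⟨j, hj, hD⟩ => exp_le_potential hl hj hD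
  refine ENNReal.toReal_le_of_le_ofReal (by positivity) ?_
  calc μ _ ≤ μ {ω | ENNReal.ofReal (Real.exp (l * D)) ≤ φ ω} := measure_mono hfar
    _ ≤ (∫⁻ ω, φ ω ∂μ) / ENNReal.ofReal (Real.exp (l * D)) :=
        meas_ge_le_lintegral_div hφ.aemeasurable (by simp [Real.exp_pos]) ENNReal.ofReal_ne_top
    _ ≤ ENNReal.ofReal (Real.exp (-(l * D)) * (1 + Real.exp (l * r) / w) ^ t) := by
        rw [Real.exp_neg, ENNReal.ofReal_mul (by positivity),
          ENNReal.ofReal_inv_of_pos (Real.exp_pos _), div_eq_mul_inv, mul_comm]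
        gcongr
        exact hP.lintegral_potential_le hw hH hl r c s t

theorem measureReal_exists_shortReach_far_le [IsProbabilityMeasure μ]
    (hP : IsRandomPush μ R keep ℱ X H₀ act) (hw : 0 < w)
    (hH : ∀ᵐ ω ∂μ, ∀ i, w ≤ (H₀ ω i).card) {l : ℝ} (hl : 0 ≤ l) (r D : ℝ) (c : Fin k)
    (t : ℕ) :
    μ.real {ω | ∃ s, ∃ j ∈ shortReach r (fun i => X i ω) (fun u => act u ω) c s t,
      D ≤ dist (X s ω) (X j ω)} ≤
      n * (Real.exp (-(l * D)) * (1 + Real.exp (l * r) / w) ^ t) := by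
  rw [Set.ofPred_exists]
  refine (measureReal_iUnion_fintype_le _).trans ((Finset.sum_le_card_nsmul _ _ _ fun s _ =>
    hP.measureReal_shortReach_far_le hw hH hl r D c s t).trans_eq ?_)
  rw [Finset.card_univ, Fintype.card_fin, nsmul_eq_mul]

end ExpectedPotential

section SpreadTime

variable [IsProbabilityMeasure μ] {w : ℕ} {c : Fin k} {m : ℕ}

theorem ae_empty_corner_or_long_link_or_far (hP : IsRandomPush μ R keep ℱ X H₀ act)
    (hkeep : ∀ j s, keep j s ⊆ s) (hc : ∀ᵐ ω ∂μ, ∃! i, c ∈ H₀ ω i) (hm : 4 ≤ m)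
    {p q : Fin 2 → Fin m} (hp : (p 0 : ℕ) = 0) (hq : (q 0 : ℕ) = m - 1) (T : ℕ) :
    ∀ᵐ ω ∂μ, (∀ i, c ∈ pastHoldings R keep X H₀ act T ω i) →
      (∀ i, X i ω ∉ cell m p) ∨ (∀ i, X i ω ∉ cell m q) ∨
      (∃ t < T, ∃ i j, act t ω i = some c ∧ IsLink (fun l => X l ω) (act t ω) i j ∧
        2 / m < dist (X i ω) (X j ω)) ∨
      ∃ s, ∃ j ∈ shortReach (2 / m) (fun i => X i ω) (fun u => act u ω) c s T,
        1 / 4 ≤ dist (X s ω) (X j ω) := by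
  filter_upwards [hc, hP.ae_mem_pastHoldings] with ω ⟨s, _, hs⟩ hact hall
  by_contra! ⟨⟨i, hi⟩, ⟨j, hj⟩, hshort, hnear⟩
  obtain ⟨l, hl, hfar⟩ := exists_far_mem_shortReach hkeep hs (fun u i => hact u i c) hshort hall
    (half_le_dist_of_mem_cell hm hp hq hi hj)
  linarith [hnear s l hl]

theorem measureReal_forall_mem_pastHoldings_le (hP : IsRandomPush μ R keep ℱ X H₀ act)
    (hkeep : ∀ j s, keep j s ⊆ s) (hw : 0 < w) (hH : ∀ᵐ ω ∂μ, ∀ i, w ≤ (H₀ ω i).card)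
    (hc : ∀ᵐ ω ∂μ, ∃! i, c ∈ H₀ ω i) (hm : 4 ≤ m) (T : ℕ) :
    μ.real {ω | ∀ i, c ∈ pastHoldings R keep X H₀ act T ω i} ≤
      2 * (1 - 1 / (m : ℝ) ^ 2) ^ n +
        T * (m ^ 2 * (n * (1 / w * (1 - (1 - R.sendProb) / m ^ 2) ^ n))) +
        n * (Real.exp (-(m / 8)) * (1 + Real.exp 1 / w) ^ T) := by
  let p : Fin 2 → Fin m := fun _ => ⟨0, by omega⟩
  let q : Fin 2 → Fin m := fun _ => ⟨m - 1, by omega⟩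
  let empty : (Fin 2 → Fin m) → Set Ω := fun p => {ω | ∀ i, X i ω ∉ cell m p}
  let long : Set Ω := {ω | ∃ t < T, ∃ i j, act t ω i = some c ∧
    IsLink (fun l => X l ω) (act t ω) i j ∧ 2 / m < dist (X i ω) (X j ω)}
  let far : Set Ω := {ω | ∃ s, ∃ j ∈ shortReach (2 / m) (fun i => X i ω) (fun u => act u ω) c s T,
    1 / 4 ≤ dist (X s ω) (X j ω)}
  have hempty : ∀ p, μ.real (empty p) = (1 - 1 / (m : ℝ) ^ 2) ^ n := fun p => by
    rw [hP.measureReal_forall_notMem (measurableSet_cell m p),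
      measureReal_restrict_unitSquare_cell]
  have hlong : μ.real long ≤ T * (m ^ 2 * (n * (1 / w * (1 - (1 - R.sendProb) / m ^ 2) ^ n))) :=
    hP.measureReal_exists_long_link_le hw hH (by omega) T c
  have hfar : μ.real far ≤ n * (Real.exp (-(m / 8)) * (1 + Real.exp 1 / w) ^ T) := by
    have hlr : (m : ℝ) / 2 * (2 / m) = 1 := by field_simp
    have hlD : (m : ℝ) / 2 * (1 / 4) = m / 8 := by ring
    simpa only [hlr, hlD] using hP.measureReal_exists_shortReach_far_le hw hH (l := m / 2)
      (by positivity) (2 / m) (1 / 4) c T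
  calc _ ≤ μ.real (empty p ∪ (empty q ∪ (long ∪ far))) :=
        ENNReal.toReal_mono (measure_ne_top _ _)
          (measure_mono_ae (hP.ae_empty_corner_or_long_link_or_far hkeep hc hm rfl rfl T))
    _ ≤ μ.real (empty p) + (μ.real (empty q) + (μ.real long + μ.real far)) := by
        grw [measureReal_union_le, measureReal_union_le, measureReal_union_le]
    _ ≤ _ := by
        rw [hempty, hempty]
        linarith

theorem lt_measureReal_lt_spreadTime (hP : IsRandomPush μ R keep ℱ X H₀ act)
    (hkeep : ∀ j s, keep j s ⊆ s) (hw : 0 < w) (hH : ∀ᵐ ω ∂μ, ∀ i, w ≤ (H₀ ω i).card)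
    (hc : ∀ᵐ ω ∂μ, ∃! i, c ∈ H₀ ω i) (hL : 1 ≤ Real.log n)
    (hcube : 512 ^ 2 * Real.log n ^ 3 ≤ n) {B : ℝ} (hB : B ≤ w / 512 * √(n / Real.log n)) :
    1 - ((n : ℝ) ^ 2)⁻¹ < μ.real {ω | ENNReal.ofReal B <
      (R.spreadTime keep (fun i => X i ω) (H₀ ω) (fun t => act t ω) c : ℝ≥0∞)} := by
  set slow := {ω | ENNReal.ofReal B <
    (R.spreadTime keep (fun i => X i ω) (H₀ ω) (fun t => act t ω) c : ℝ≥0∞)}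
  have hT : (⌊B⌋₊ : ℝ) ≤ w / 512 * √(n / Real.log n) :=
    (Nat.cast_le.2 (Nat.floor_mono hB)).trans (Nat.floor_le (by positivity))
  have hfast : μ.real slowᶜ < ((n : ℝ) ^ 2)⁻¹ :=
    calc μ.real slowᶜ ≤ μ.real {ω | ∀ i, c ∈ pastHoldings R keep X H₀ act ⌊B⌋₊ ω i} :=
          measureReal_mono fun ω hω =>
            Radio.mem_holdings_floor_of_spreadTime_le (not_lt.1 hω)
      _ ≤ _ := hP.measureReal_forall_mem_pastHoldings_le hkeep hw hH hc
          (four_le_gridSize hL hcube) ⌊B⌋₊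
      _ < _ := union_bound_lt_inv_sq R.sendProb_pos.le R.sendProb_lt.le hL hcube hw hT
  have htotal : 1 ≤ μ.real slow + μ.real slowᶜ := by
    simpa using measureReal_union_le (μ := μ) slow slowᶜ
  linarith

end SpreadTime

end IsRandomPush

end PushDynamics

end Gossip

theorem theorem2_general (R : Gossip.Radio) (w : ℕ → ℕ) (hw : Tendsto w atTop atTop)
    (ε : ℝ) (hε : 0 < ε) :
    ∀ᶠ n : ℕ in atTop, ∀ (k : ℕ) (keep : Gossip.ReceptionRule n), (∀ j s, keep j s ⊆ s) →
      ∀ (Ω : Type*) [mΩ : MeasurableSpace Ω] (μ : Measure Ω) [IsProbabilityMeasure μ]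
        (ℱ : Filtration ℕ mΩ) (X : Fin n → Ω → Gossip.Plane)
        (H₀ : Ω → Gossip.Holdings n k) (act : ℕ → Ω → Gossip.Action n k) (Mstar : Fin k),
        Gossip.IsRandomPush μ R keep ℱ X H₀ act →
        (∀ᵐ ω ∂μ, ∃! i, Mstar ∈ H₀ ω i) →
        (∀ᵐ ω ∂μ, ∀ i, w n ≤ ((H₀ ω i).erase Mstar).card) →
        1 - ((n : ℝ) ^ 2)⁻¹ <
          μ.real {ω | ENNReal.ofReal ((w n : ℝ) ^ (1 - ε) * √(n / (128 * Real.log n))) <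
            (R.spreadTime keep (fun i => X i ω) (H₀ ω) (fun t => act t ω) Mstar : ℝ≥0∞)} := by
  have hlog := Real.tendsto_log_atTop.comp (tendsto_natCast_atTop_atTop (R := ℝ))
  have hwε := (tendsto_rpow_atTop hε).comp ((tendsto_natCast_atTop_atTop (R := ℝ)).comp hw)
  filter_upwards [hlog.eventually_ge_atTop 1, Gossip.eventually_mul_log_pow_le (512 ^ 2) 3,
    hw.eventually_ge_atTop 1, hwε.eventually_ge_atTop 512] with n hL hcube hw1 hwε
    k keep hkeep Ω mΩ μ _ ℱ X H₀ act Mstar hP hsource hheld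
  have hH : ∀ᵐ ω ∂μ, ∀ i, w n ≤ (H₀ ω i).card :=
    hheld.mono fun ω hω i => (hω i).trans (Finset.card_le_card (Finset.erase_subset _ _))
  exact hP.lt_measureReal_lt_spreadTime hkeep hw1 hH hsource hL hcube
    (Gossip.rpow_one_sub_mul_sqrt_le (by exact_mod_cast hw1) n.cast_nonneg
      (zero_le_one.trans hL) hwε)

theorem theorem2 (R : Gossip.Radio) (w : ℕ → ℕ) (hw : Gossip.SuperPolylog w)
    (ε : ℝ) (hε : 0 < ε) :
    ∀ᶠ n : ℕ in atTop, ∀ (k : ℕ), k ≤ n →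
      ∀ (keep : Gossip.ReceptionRule n), (∀ j s, keep j s ⊆ s) →
      ∀ (Ω : Type*) [mΩ : MeasurableSpace Ω] (μ : Measure Ω) [IsProbabilityMeasure μ]
        (ℱ : Filtration ℕ mΩ) (X : Fin n → Ω → Gossip.Plane)
        (H₀ : Ω → Gossip.Holdings n k) (act : ℕ → Ω → Gossip.Action n k) (Mstar : Fin k),
        Gossip.IsRandomPush μ R keep ℱ X H₀ act →
        -- exactly one node, the source, possesses the new message at time 0
        (∀ᵐ ω ∂μ, ∃! i, Mstar ∈ H₀ ω i) →
        -- every node has received at least `w n` of the other messages by time 0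
        (∀ᵐ ω ∂μ, ∀ i, w n ≤ ((H₀ ω i).erase Mstar).card) →
        1 - ((n : ℝ) ^ 2)⁻¹ <
          μ.real {ω | ENNReal.ofReal ((w n : ℝ) ^ (1 - ε) * √(n / (128 * Real.log n))) <
            (R.spreadTime keep (fun i => X i ω) (H₀ ω) (fun t => act t ω) Mstar : ℝ≥0∞)} := by
  filter_upwards [theorem2_general R w hw.tendsto_atTop ε hε] with n h k _ using h k
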